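/- Let $N$ be a natural number, let $\mathcal A$ be the real vector space of Hermitian complex $N\times N$ matrices, and let $\widehat{\mathcal M}\subset\mathcal A$ be the manifold of positive definite matrices, an open subset of $\mathcal A$ of dimension $n+1=N^2$; thus $T_\sigma\widehat{\mathcal M}=\mathcal A$ for every $\sigma\in\widehat{\mathcal M}$. For $\alpha\in(-1,1)$ let $\ell_\alpha(\sigma)=\frac{2}{1-\alpha}\,\sigma^{\frac{1-\alpha}{2}}$, and for $A\in T_\sigma\widehat{\mathcal M}$ let $A^{(\alpha)}=d(\ell_\alpha)_\sigma(A)\in\mathcal A$ be its $\alpha$-representation. The $\alpha$-connection $\nabla^{(\alpha)}$ on $\widehat{\mathcal M}$ is defined by $$(\nabla^{(\alpha)}_XY)_\sigma=\bigl(d(\ell_\alpha)_\sigma\bigr)^{-1}\bigl(D_{X_\sigma}(Y^{(\alpha)})\bigr),$$ where $Y^{(\alpha)}$ denotes the $\mathcal A$-valued function $\tau\mapsto (Y_\tau)^{(\alpha)}$ and $D_{X_\sigma}$ is the ordinary directional derivative at $\sigma$ in the direction $X_\sigma$. The Wigner–Yanase–Dyson metric is $$\widehat g^{(\alpha)}_\sigma(A,B)=\operatorname{Tr}\bigl(A^{(\alpha)}B^{(-\alpha)}\bigr),\qquad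 A,B\in T_\sigma\widehat{\mathcal M}.$$ Fix $\alpha\in(-1,1)$ and let $\widehat g$ be a smooth Riemannian metric on $\widehat{\mathcal M}$ with respect to which $\nabla^{(\alpha)}$ and $\nabla^{(-\alpha)}$ are dual, that is, $$X\,\widehat g(Y,Z)=\widehat g(\nabla^{(\alpha)}_XY,Z)+\widehat g(Y,\nabla^{(-\alpha)}_XZ)$$ for all smooth vector fields $X,Y,Z$ on $\widehat{\mathcal M}$. Then there exist a global smooth coordinate system $\theta=(\theta^1,\dots,\theta^{n+1})$ on $\widehat{\mathcal M}$ (a diffeomorphism onto an open subset of $\mathbb R^{n+1}$) that is $\nabla^{(\alpha)}$-affine, i.e. $\nabla^{(\alpha)}_{\partial/\partial\theta^i}\frac{\partial}{\partial\theta^j}=0$ for all $i,j$, and a constant (independent of $\sigma$) real $(n+1)\times(n+1)$ matrix $M=(M_i^k)$ such that, for all $\sigma\in\widehat{\mathcal M}$ and all $i,j$, $$\widehat g_\sigma\Bigl(\frac{\partial}{\partial\theta^i},\frac{\partial}{\partial\theta^j}\Bigr)=\sum_{k=1}^{n+1}M_i^k\;\widehat g^{(\alpha)}_\sigma\Bigl(\frac{\partial}{\partial\theta^k},\frac{\partial}{\partial\theta^j}\Bigr).$$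 -/

import Mathlib

namespace AlphaGeometry

noncomputable section

open scoped Matrix.Norms.L2Operator ContDiff ComplexOrder

/-- The real vector space of self-adjoint (Hermitian) complex `N × N` matrices,
of real dimension `N ^ 2`. -/
def Herm (N : ℕ) : Type := selfAdjoint (Matrix (Fin N) (Fin N) ℂ)

/-- `Herm N` carries the operator norm. The choice of a norm is immaterial, since the space is
finite dimensional. -/
instance (N : ℕ) : NormedAddCommGroup (Herm N) :=
  inferInstanceAs (NormedAddCommGroup (selfAdjoint (Matrix (Fin N) (Fin N) ℂ)))

instance (N : ℕ) : NormedSpace ℝ (Herm N) :=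
  inferInstanceAs (NormedSpace ℝ (selfAdjoint (Matrix (Fin N) (Fin N) ℂ)))

/-- The underlying matrix. -/
def Herm.mat {N : ℕ} (σ : Herm N) : Matrix (Fin N) (Fin N) ℂ := σ.1

/-- The manifold of positive definite matrices, an open subset of `Herm N`.
Its tangent space at every point is `Herm N`. -/
def posDef (N : ℕ) : Set (Herm N) := {σ | σ.mat.PosDef}

/-- The power `σ ^ p` of a self-adjoint matrix, by functional calculus.
It is used only at positive definite `σ`. -/
def power {N : ℕ} (p : ℝ) (σ : Herm N) : Herm N :=
  ⟨cfc (fun x : ℝ => x ^ p) σ.mat,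
    cfc_predicate (fun x : ℝ => x ^ p) σ.mat⟩

/-- The `α`-embedding `σ ↦ 2 / (1 - α) • σ ^ ((1 - α) / 2)`. -/
def embed {N : ℕ} (α : ℝ) (σ : Herm N) : Herm N :=
  (2 / (1 - α)) • power ((1 - α) / 2) σ

/-- The differential of the `α`-embedding at `σ`: it sends a tangent vector at `σ` to its
`α`-representation. -/
def alphaRep {N : ℕ} (α : ℝ) (σ : Herm N) : Herm N →L[ℝ] Herm N :=
  fderiv ℝ (embed α) σ

/-- Smooth vector fields on the manifold of positive definite matrices. -/
def IsSmoothField {N : ℕ} (X : Herm N → Herm N) : Prop :=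
  ContDiffOn ℝ ∞ X (posDef N)

/-- The covariant derivative `∇_X Y` of the `α`-connection: push `Y` forward by the
`α`-embedding, differentiate the result in the direction of `X` as a vector-valued function,
and pull the outcome back. -/
def alphaConnection {N : ℕ} (α : ℝ) (X Y : Herm N → Herm N) (σ : Herm N) : Herm N :=
  (alphaRep α σ).inverse (fderiv ℝ (fun τ => alphaRep α τ (Y τ)) σ (X σ))

/-- A smooth Riemannian metric on the manifold of positive definite matrices. -/
structure RiemannianMetric (N : ℕ) where
  form : Herm N → Herm N →L[ℝ] Herm N →L[ℝ] ℝ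
  smooth : ContDiffOn ℝ ∞ form (posDef N)
  symm : ∀ σ ∈ posDef N, ∀ A B : Herm N, form σ A B = form σ B A
  pos : ∀ σ ∈ posDef N, ∀ A : Herm N, A ≠ 0 → 0 < form σ A A

/-- Duality of two covariant derivatives with respect to a Riemannian metric:
`X g(Y, Z) = g(∇_X Y, Z) + g(Y, ∇'_X Z)`. -/
def AreDual {N : ℕ} (g : RiemannianMetric N)
    (nabla nabla' : (Herm N → Herm N) → (Herm N → Herm N) → Herm N → Herm N) : Prop :=
  ∀ X Y Z : Herm N → Herm N, IsSmoothField X → IsSmoothField Y → IsSmoothField Z →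
    ∀ σ ∈ posDef N,
      fderiv ℝ (fun τ => g.form τ (Y τ) (Z τ)) σ (X σ) =
        g.form σ (nabla X Y σ) (Z σ) + g.form σ (Y σ) (nabla' X Z σ)

/-- The Wigner–Yanase–Dyson metric: `Tr (A⁽ᵅ⁾ B⁽⁻ᵅ⁾)`. This trace of a product of two
self-adjoint matrices is a real number. -/
def wyd {N : ℕ} (α : ℝ) (σ A B : Herm N) : ℝ :=
  (Matrix.trace ((alphaRep α σ A).mat *
    (alphaRep (-α) σ B).mat)).re

/-- A global smooth coordinate system on the manifold of positive definite matrices: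
a diffeomorphism onto an open subset of `ℝ ^ (N ^ 2)`. -/
structure CoordinateSystem (N : ℕ) where
  chart : OpenPartialHomeomorph (Herm N) (Fin (N ^ 2) → ℝ)
  source_eq : chart.source = posDef N
  smooth : ContDiffOn ℝ ∞ chart chart.source
  smooth_symm : ContDiffOn ℝ ∞ chart.symm chart.target

/-- The coordinate vector field `∂ / ∂θ^i`. -/
def CoordinateSystem.partialField {N : ℕ} (θ : CoordinateSystem N) (i : Fin (N ^ 2))
    (σ : Herm N) : Herm N :=
  fderiv ℝ θ.chart.symm (θ.chart σ) (Pi.single i 1)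

/-- The coordinate system is affine for the given covariant derivative: all the covariant
derivatives of the coordinate vector fields along each other vanish. -/
def CoordinateSystem.IsAffine {N : ℕ} (θ : CoordinateSystem N)
    (nabla : (Herm N → Herm N) → (Herm N → Herm N) → Herm N → Herm N) : Prop :=
  ∀ i j : Fin (N ^ 2), ∀ σ ∈ posDef N, nabla (θ.partialField i) (θ.partialField j) σ = 0

end

end AlphaGeometry

/-! The `α`-embedding is a diffeomorphism of the positive cone onto itself, with inverse `unembed`.
Constant vectors pulled back through it are the fields `alphaLift α · A`. They are `∇^(α)`-parallel,
since their `α`-representation is constant, and they are the coordinate fields of linear coordinates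
composed with the embedding; this gives the affine chart. Pair an `α`-parallel field with a
`(-α)`-parallel one: by duality the derivative of `g` on the pair vanishes, so `g` is constant on
the connected cone (`form_alphaLift_const`). The Wigner–Yanase–Dyson metric on such a pair is the
trace form of two fixed matrices. That form is nondegenerate, so the two constant pairings differ by
a fixed linear change of the first argument, whose matrix is `M`. The analytic input is smoothness
of `σ ↦ σ ^ p` (`contDiffOn_power`), obtained by expanding the functional calculus in a binomial
series about a large scalar matrix. -/

/-! ### Real powers by functional calculus as binomial series. -/

section BinomialSeries

variable {A : Type*} [CStarAlgebra A]

theorem one_le_radius_binomialSeries (p : ℝ) : 1 ≤ (binomialSeries A p).radius := by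
  refine ENNReal.le_of_forall_nnreal_lt fun r hr => ?_
  have hs := (binomialSeries ℝ p).summable_norm_mul_pow
    (hr.trans_le binomialSeries_radius_ge_one)
  refine FormalMultilinearSeries.le_radius_of_eventually_le _
    (∑' n, ‖binomialSeries ℝ p n‖ * (r : ℝ) ^ n) ?_
  filter_upwards [Filter.eventually_gt_atTop 0] with n hn
  refine le_trans ?_ (hs.le_tsum n fun m _ => by positivity)
  gcongr
  unfold binomialSeries
  rw [FormalMultilinearSeries.ofScalars_norm (E := ℝ)]
  exact FormalMultilinearSeries.ofScalars_norm_le _ _ _ hn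

theorem abs_le_norm_of_mem_spectrum {a : A} {t : ℝ} (ht : t ∈ spectrum ℝ a) : |t| ≤ ‖a‖ := by
  rcases subsingleton_or_nontrivial A with h | h
  · simp [spectrum.of_subsingleton] at ht
  · exact spectrum.norm_le_norm_of_mem ht

/-- The spectrum lies in `[-‖a‖, ‖a‖]`, inside the disc of convergence, so the scalar series
converges uniformly there and the functional calculus passes to the limit. -/
theorem cfc_one_add_rpow_eq_binomialSeries_sum (p : ℝ) {a : A} (ha : IsSelfAdjoint a)
    (hnorm : ‖a‖ < 1) :
    cfc (fun t : ℝ => (1 + t) ^ p) a = (binomialSeries A p).sum a := by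
  have hs : Summable fun n => ‖binomialSeries ℝ p n‖ * ‖a‖ ^ n :=
    (binomialSeries ℝ p).summable_norm_mul_pow (r := ‖a‖₊)
      (lt_of_lt_of_le (by exact_mod_cast hnorm) binomialSeries_radius_ge_one)
  have hunif : TendstoUniformlyOn
      (fun (s : Finset ℕ) (t : ℝ) => ∑ n ∈ s, Ring.choose p n * t ^ n)
      (fun t => (1 + t) ^ p) Filter.atTop (spectrum ℝ a) := by
    refine (tendstoUniformlyOn_tsum hs (f := fun n (t : ℝ) => Ring.choose p n * t ^ n)
      fun n t ht => ?_).congr_right fun t ht => ?_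
    · rw [binomialSeries, FormalMultilinearSeries.ofScalars_norm, norm_mul, norm_pow]
      gcongr
      exact abs_le_norm_of_mem_spectrum ht
    · have hmem : t ∈ Metric.eball (0 : ℝ) 1 := by
        have := (abs_le_norm_of_mem_spectrum ht).trans_lt hnorm
        rw [← ENNReal.ofReal_one, Metric.eball_ofReal]
        simpa using this
      have := (Real.one_add_rpow_hasFPowerSeriesOnBall_zero (a := p)).hasSum hmem
      simpa [binomialSeries, FormalMultilinearSeries.ofScalars_apply_eq, mul_comm]
        using this.tsum_eq
  have hlim := tendsto_cfc_fun hunif (Filter.Eventually.of_forall fun s => by fun_prop)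
  have hlim' : HasSum (fun n => Ring.choose p n • a ^ n) (cfc (fun t : ℝ => (1 + t) ^ p) a) := by
    refine hlim.congr fun s => ?_
    rw [← Finset.sum_fn s fun n (t : ℝ) => Ring.choose p n * t ^ n,
      cfc_sum _ _ _ (fun i _ => by fun_prop)]
    refine Finset.sum_congr rfl fun n _ => ?_
    rw [cfc_const_mul _ _ _ (by fun_prop), cfc_pow_id a n]
  rw [FormalMultilinearSeries.sum, ← hlim'.tsum_eq]
  simp [binomialSeries, FormalMultilinearSeries.ofScalars_apply_eq]

/-- Rescaling: `a = c (1 + b)` with `‖b‖ < 1`, and `t ^ p` is multiplicative on positive reals. -/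
theorem cfc_rpow_eq_binomialSeries_sum (p : ℝ) {a : A} (ha : IsSelfAdjoint a) {c : ℝ}
    (hc : ‖a - algebraMap ℝ A c‖ < c) :
    cfc (fun t : ℝ => t ^ p) a =
      c ^ p • (binomialSeries A p).sum (c⁻¹ • (a - algebraMap ℝ A c)) := by
  have hc0 : 0 < c := (norm_nonneg _).trans_lt hc
  set b := c⁻¹ • (a - algebraMap ℝ A c) with hb
  have hbs : IsSelfAdjoint b := by
    refine IsSelfAdjoint.smul (by rfl) (ha.sub ?_)
    exact IsSelfAdjoint.algebraMap A (by rfl)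
  have hbn : ‖b‖ < 1 := by
    rw [hb, norm_smul, norm_inv, Real.norm_of_nonneg hc0.le, inv_mul_lt_iff₀ hc0]
    simpa using hc
  have hpos : ∀ t ∈ spectrum ℝ b, 0 < 1 + t := fun t ht => by
    have := (abs_lt.1 ((abs_le_norm_of_mem_spectrum ht).trans_lt hbn)).1
    linarith
  have hab : cfc (fun t : ℝ => c * (1 + t)) b = a := by
    rw [cfc_const_mul _ _ _ (by fun_prop), cfc_const_add _ _ _ (by fun_prop), cfc_id' ℝ b, hb,
      smul_add, smul_inv_smul₀ hc0.ne', map_one, ← Algebra.algebraMap_eq_smul_one]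
    simp
  have hcont : ContinuousOn (fun t : ℝ => (1 + t) ^ p) (spectrum ℝ b) := fun t ht =>
    ((continuousAt_const.add continuousAt_id).rpow_const
      (.inl (hpos t ht).ne')).continuousWithinAt
  have hcont' : ContinuousOn (fun t : ℝ => t ^ p)
      ((fun t : ℝ => c * (1 + t)) '' spectrum ℝ b) := by
    rintro _ ⟨t, ht, rfl⟩
    exact (Real.continuousAt_rpow_const _ _
      (.inl (mul_pos hc0 (hpos t ht)).ne')).continuousWithinAt
  rw [← cfc_one_add_rpow_eq_binomialSeries_sum p hbs hbn, ← cfc_const_mul _ _ _ hcont]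
  conv_lhs => rw [← hab]
  rw [← cfc_comp' _ _ b hcont' (by fun_prop) hbs]
  exact cfc_congr fun t ht => Real.mul_rpow hc0.le (hpos t ht).le

theorem analyticAt_binomialSeries_sum (p : ℝ) {a : A} (ha : ‖a‖ < 1) :
    AnalyticAt ℝ (binomialSeries A p).sum a := by
  have hr := one_le_radius_binomialSeries (A := A) p
  refine ((binomialSeries A p).hasFPowerSeriesOnBall (one_pos.trans_le hr)).analyticAt_of_mem ?_
  refine Metric.eball_subset_eball hr ?_
  rw [← ENNReal.ofReal_one, Metric.eball_ofReal]
  simpa using ha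

end BinomialSeries

namespace AlphaGeometry

noncomputable section

open scoped Matrix.Norms.L2Operator ContDiff ComplexOrder MatrixOrder

variable {N : ℕ} {α : ℝ}

/-! ### The positive cone and smoothness of powers on it. -/

theorem Herm.mat_injective : Function.Injective (Herm.mat (N := N)) := Subtype.val_injective

theorem Herm.isSelfAdjoint (σ : Herm N) : IsSelfAdjoint σ.mat := σ.2

@[simp] theorem mat_power (p : ℝ) (σ : Herm N) :
    (power p σ).mat = cfc (fun x : ℝ => x ^ p) σ.mat := rfl

/-- The inclusion of Hermitian matrices into all matrices, as a continuous linear map. -/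
def Herm.matL (N : ℕ) : Herm N →L[ℝ] Matrix (Fin N) (Fin N) ℂ where
  toFun := Herm.mat
  map_add' _ _ := rfl
  map_smul' _ _ := rfl
  cont := continuous_subtype_val

@[simp] theorem Herm.matL_apply (σ : Herm N) : Herm.matL N σ = σ.mat := rfl

/-- The Hermitian part of a matrix, as a continuous linear map. -/
def Herm.part (N : ℕ) : Matrix (Fin N) (Fin N) ℂ →L[ℝ] Herm N :=
  selfAdjointPartL ℝ (Matrix (Fin N) (Fin N) ℂ)

theorem Herm.part_mat (σ : Herm N) : Herm.part N σ.mat = σ := σ.2.selfAdjointPart_apply ℝ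

theorem mem_posDef_iff_spectrum_pos {σ : Herm N} :
    σ ∈ posDef N ↔ ∀ x ∈ spectrum ℝ σ.mat, 0 < x :=
  Matrix.isStrictlyPositive_iff_posDef.symm.trans
    (StarOrderedRing.isStrictlyPositive_iff_spectrum_pos σ.mat σ.isSelfAdjoint)

theorem mem_posDef_of_norm_sub_lt {σ : Herm N} {c : ℝ}
    (h : ‖σ.mat - algebraMap ℝ _ c‖ < c) : σ ∈ posDef N := by
  refine mem_posDef_iff_spectrum_pos.2 fun x hx => ?_
  have hx' : x - c ∈ spectrum ℝ (σ.mat - algebraMap ℝ _ c) := by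
    rw [← spectrum.sub_singleton_eq]
    exact ⟨x, hx, c, rfl, rfl⟩
  have := (abs_lt.1 ((abs_le_norm_of_mem_spectrum hx').trans_lt h)).1
  linarith

/-- The spectrum lies in `(0, ‖σ‖]`, hence at distance less than `‖σ‖ + 1` from `‖σ‖ + 1`. The same
strict inequality serves for openness of the cone and for convergence of the series. -/
theorem norm_sub_lt_of_mem_posDef {σ : Herm N} (hσ : σ ∈ posDef N) :
    ‖σ.mat - algebraMap ℝ _ (‖σ.mat‖ + 1)‖ < ‖σ.mat‖ + 1 := by
  set c := ‖σ.mat‖ + 1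
  have : cfc (fun x : ℝ => x - c) σ.mat = σ.mat - algebraMap ℝ _ c := by
    rw [cfc_sub (fun x : ℝ => x) (fun _ => c) σ.mat (by fun_prop) (by fun_prop),
      cfc_id' ℝ σ.mat σ.isSelfAdjoint, cfc_const c σ.mat σ.isSelfAdjoint]
  rw [← this]
  refine norm_cfc_lt (by positivity) fun x hx => ?_
  have h1 := mem_posDef_iff_spectrum_pos.1 hσ x hx
  have h2 := (abs_le.1 (abs_le_norm_of_mem_spectrum hx)).2
  rw [Real.norm_eq_abs, abs_lt]
  constructor <;> linarith

theorem isOpen_posDef : IsOpen (posDef N) := by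
  refine isOpen_iff_mem_nhds.2 fun σ hσ => ?_
  have hcont : Continuous fun τ : Herm N => ‖τ.mat - algebraMap ℝ _ (‖σ.mat‖ + 1)‖ :=
    ((Herm.matL N).continuous.sub continuous_const).norm
  filter_upwards [hcont.continuousAt.eventually_lt_const (norm_sub_lt_of_mem_posDef hσ)]
    with τ hτ using mem_posDef_of_norm_sub_lt hτ

theorem smul_mem_posDef {c : ℝ} (hc : 0 < c) {σ : Herm N} (hσ : σ ∈ posDef N) :
    c • σ ∈ posDef N :=
  Matrix.PosDef.smul hσ hc

theorem convex_posDef : Convex ℝ (posDef N) :=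
  convex_iff_forall_pos.2 fun _ hx _ hy _ _ ha hb _ =>
    Matrix.PosDef.add (smul_mem_posDef ha hx) (smul_mem_posDef hb hy)

theorem contDiffOn_power (p : ℝ) : ContDiffOn ℝ ∞ (power p) (posDef N) := by
  intro σ hσ
  refine ContDiffAt.contDiffWithinAt ?_
  set c := ‖σ.mat‖ + 1
  have hc0 : 0 < c := by positivity
  have hlt := norm_sub_lt_of_mem_posDef hσ
  have hnorm : ‖c⁻¹ • (σ.mat - algebraMap ℝ _ c)‖ < 1 := by
    rw [norm_smul, norm_inv, Real.norm_of_nonneg hc0.le, inv_mul_lt_iff₀ hc0]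
    rwa [mul_one]
  -- The centre `c` stays fixed while `τ` varies; `Herm.part` returns the matrix-valued sum to
  -- Hermitian matrices.
  have hsmooth : ContDiffAt ℝ ∞ (fun τ : Herm N => Herm.part N (c ^ p •
      (binomialSeries (Matrix (Fin N) (Fin N) ℂ) p).sum
        (c⁻¹ • (Herm.matL N τ - algebraMap ℝ _ c)))) σ := by
    refine (Herm.part N).contDiff.contDiffAt.comp σ (ContDiffAt.const_smul (c ^ p) ?_)
    refine ContDiffAt.comp σ (g := (binomialSeries (Matrix (Fin N) (Fin N) ℂ) p).sum)
      (analyticAt_binomialSeries_sum p hnorm).contDiffAt ?_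
    exact ContDiffAt.const_smul c⁻¹ ((Herm.matL N).contDiff.contDiffAt.sub contDiffAt_const)
  have hcont : Continuous fun τ : Herm N => ‖τ.mat - algebraMap ℝ _ c‖ :=
    ((Herm.matL N).continuous.sub continuous_const).norm
  refine hsmooth.congr_of_eventuallyEq ?_
  filter_upwards [hcont.continuousAt.eventually_lt_const hlt] with τ hτ
  rw [Herm.matL_apply, ← cfc_rpow_eq_binomialSeries_sum p τ.isSelfAdjoint hτ, ← mat_power,
    Herm.part_mat]

theorem continuousOn_rpow_spectrum (p : ℝ) {σ : Herm N} (hσ : σ ∈ posDef N) :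
    ContinuousOn (fun x : ℝ => x ^ p) (spectrum ℝ σ.mat) := fun x hx =>
  (Real.continuousAt_rpow_const _ _
    (.inl (mem_posDef_iff_spectrum_pos.1 hσ x hx).ne')).continuousWithinAt

theorem power_mem_posDef (p : ℝ) {σ : Herm N} (hσ : σ ∈ posDef N) : power p σ ∈ posDef N := by
  refine mem_posDef_iff_spectrum_pos.2 fun x hx => ?_
  rw [mat_power, cfc_map_spectrum _ _ σ.isSelfAdjoint (continuousOn_rpow_spectrum p hσ)] at hx
  obtain ⟨y, hy, rfl⟩ := hx
  exact Real.rpow_pos_of_pos (mem_posDef_iff_spectrum_pos.1 hσ y hy) p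

theorem power_power_of_mul_eq_one {p q : ℝ} (hpq : q * p = 1) {σ : Herm N}
    (hσ : σ ∈ posDef N) : power p (power q σ) = σ := by
  have hpos := mem_posDef_iff_spectrum_pos.1 hσ
  refine Herm.mat_injective ?_
  rw [mat_power, mat_power, ← cfc_comp' _ _ σ.mat ?_ (continuousOn_rpow_spectrum q hσ)
    σ.isSelfAdjoint]
  · conv_rhs => rw [← cfc_id' ℝ σ.mat σ.isSelfAdjoint]
    refine cfc_congr fun x hx => ?_
    rw [← Real.rpow_mul (hpos x hx).le, hpq, Real.rpow_one]
  · rintro _ ⟨x, hx, rfl⟩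
    exact (Real.continuousAt_rpow_const _ _
      (.inl (Real.rpow_pos_of_pos (hpos x hx) q).ne')).continuousWithinAt

/-! ### The embedding as a diffeomorphism, and its parallel fields. -/

/-- The inverse of the `α`-embedding on positive definite matrices. -/
def unembed (α : ℝ) (τ : Herm N) : Herm N :=
  power (2 / (1 - α)) (((1 - α) / 2) • τ)

theorem embed_mem_posDef (hα : α < 1) {σ : Herm N} (hσ : σ ∈ posDef N) :
    embed α σ ∈ posDef N :=
  smul_mem_posDef (div_pos two_pos (sub_pos.2 hα)) (power_mem_posDef _ hσ)

theorem unembed_mem_posDef (hα : α < 1) {σ : Herm N} (hσ : σ ∈ posDef N) :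
    unembed α σ ∈ posDef N :=
  power_mem_posDef _ (smul_mem_posDef (div_pos (sub_pos.2 hα) two_pos) hσ)

theorem unembed_embed (hα : α < 1) {σ : Herm N} (hσ : σ ∈ posDef N) :
    unembed α (embed α σ) = σ := by
  have h : 1 - α ≠ 0 := (sub_pos.2 hα).ne'
  have h1 : (1 - α) / 2 * (2 / (1 - α)) = 1 := by field_simp
  rw [unembed, embed, smul_smul, h1, one_smul, power_power_of_mul_eq_one h1 hσ]

theorem embed_unembed (hα : α < 1) {σ : Herm N} (hσ : σ ∈ posDef N) :
    embed α (unembed α σ) = σ := by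
  have h : 1 - α ≠ 0 := (sub_pos.2 hα).ne'
  have h1 : 2 / (1 - α) * ((1 - α) / 2) = 1 := by field_simp
  rw [unembed, embed, power_power_of_mul_eq_one h1
    (smul_mem_posDef (div_pos (sub_pos.2 hα) two_pos) hσ), smul_smul, h1, one_smul]

theorem contDiffOn_embed (α : ℝ) : ContDiffOn ℝ ∞ (embed α) (posDef N) :=
  (contDiffOn_power _).const_smul _

theorem contDiffOn_unembed (hα : α < 1) : ContDiffOn ℝ ∞ (unembed α) (posDef N) :=
  (contDiffOn_power _).comp (contDiff_id.const_smul _).contDiffOn fun _ hσ =>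
    smul_mem_posDef (div_pos (sub_pos.2 hα) two_pos) hσ

theorem differentiableAt_embed {σ : Herm N} (hσ : σ ∈ posDef N) :
    DifferentiableAt ℝ (embed α) σ :=
  ((contDiffOn_embed α).contDiffAt (isOpen_posDef.mem_nhds hσ)).differentiableAt (by simp)

theorem differentiableAt_unembed (hα : α < 1) {σ : Herm N} (hσ : σ ∈ posDef N) :
    DifferentiableAt ℝ (unembed α) σ :=
  ((contDiffOn_unembed hα).contDiffAt (isOpen_posDef.mem_nhds hσ)).differentiableAt (by simp)

/-- The tangent vector at `σ` with a given `α`-representation. -/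
def alphaLift (α : ℝ) (σ : Herm N) : Herm N →L[ℝ] Herm N :=
  fderiv ℝ (unembed α) (embed α σ)

/-- Chain rule applied to `embed ∘ unembed = id`, which holds near `embed α σ`. -/
theorem alphaRep_comp_alphaLift (hα : α < 1) {σ : Herm N} (hσ : σ ∈ posDef N) :
    alphaRep α σ ∘L alphaLift α σ = ContinuousLinearMap.id ℝ (Herm N) := by
  have hσ' := embed_mem_posDef hα hσ
  have h := fderiv_comp (embed α σ) (g := embed α) (f := unembed α)
    (by rw [unembed_embed hα hσ]; exact differentiableAt_embed hσ)
    (differentiableAt_unembed hα hσ')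
  rw [unembed_embed hα hσ] at h
  rw [alphaRep, alphaLift, ← h, ← fderiv_id]
  refine Filter.EventuallyEq.fderiv_eq ?_
  filter_upwards [isOpen_posDef.mem_nhds hσ'] with τ hτ using embed_unembed hα hτ

theorem alphaLift_comp_alphaRep (hα : α < 1) {σ : Herm N} (hσ : σ ∈ posDef N) :
    alphaLift α σ ∘L alphaRep α σ = ContinuousLinearMap.id ℝ (Herm N) := by
  rw [alphaRep, alphaLift, ← fderiv_comp σ
    (differentiableAt_unembed hα (embed_mem_posDef hα hσ)) (differentiableAt_embed hσ),
    ← fderiv_id]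
  refine Filter.EventuallyEq.fderiv_eq ?_
  filter_upwards [isOpen_posDef.mem_nhds hσ] with τ hτ using unembed_embed hα hτ

theorem alphaRep_alphaLift (hα : α < 1) {σ : Herm N} (hσ : σ ∈ posDef N) (A : Herm N) :
    alphaRep α σ (alphaLift α σ A) = A :=
  DFunLike.congr_fun (alphaRep_comp_alphaLift hα hσ) A

theorem alphaLift_alphaRep (hα : α < 1) {σ : Herm N} (hσ : σ ∈ posDef N) (A : Herm N) :
    alphaLift α σ (alphaRep α σ A) = A :=
  DFunLike.congr_fun (alphaLift_comp_alphaRep hα hσ) A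

theorem isSmoothField_alphaLift (hα : α < 1) (A : Herm N) :
    IsSmoothField fun σ => alphaLift α σ A := by
  have h : ContDiffOn ℝ ∞ (fun σ : Herm N => alphaLift α σ) (posDef N) :=
    ((contDiffOn_unembed hα).fderiv_of_isOpen isOpen_posDef (m := ∞) (by simp)).comp
      (contDiffOn_embed α) fun _ hσ => embed_mem_posDef hα hσ
  exact h.clm_apply contDiffOn_const

/-- The `α`-representation of `Y` is constant near `σ`. Agreement is asked only on the cone so that
coordinate fields qualify. -/
theorem alphaConnection_eq_zero_of_eqOn_alphaLift (hα : α < 1) {X Y : Herm N → Herm N}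
    {A : Herm N} (hY : Set.EqOn Y (fun σ => alphaLift α σ A) (posDef N)) {σ : Herm N}
    (hσ : σ ∈ posDef N) : alphaConnection α X Y σ = 0 := by
  have h : (fun τ => alphaRep α τ (Y τ)) =ᶠ[nhds σ] fun _ => A := by
    filter_upwards [isOpen_posDef.mem_nhds hσ] with τ hτ
    rw [hY hτ, alphaRep_alphaLift hα hτ]
  rw [alphaConnection, h.fderiv_eq]
  simp

/-- In the frames parallel for a pair of dual connections, the metric is constant. -/
theorem form_alphaLift_const (hα : α ∈ Set.Ioo (-1 : ℝ) 1) (g : RiemannianMetric N)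
    (hdual : AreDual g (alphaConnection α) (alphaConnection (-α))) (A B : Herm N)
    {σ τ : Herm N} (hσ : σ ∈ posDef N) (hτ : τ ∈ posDef N) :
    g.form σ (alphaLift α σ A) (alphaLift (-α) σ B) =
      g.form τ (alphaLift α τ A) (alphaLift (-α) τ B) := by
  have hα' : -α < 1 := by linarith [hα.1]
  have hA := isSmoothField_alphaLift hα.2 A
  have hB := isSmoothField_alphaLift hα' B
  have hsmooth : ContDiffOn ℝ ∞
      (fun σ => g.form σ (alphaLift α σ A) (alphaLift (-α) σ B)) (posDef N) :=
    (g.smooth.clm_apply hA).clm_apply hB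
  refine isOpen_posDef.is_const_of_fderiv_eq_zero (𝕜 := ℝ)
    (f := fun σ => g.form σ (alphaLift α σ A) (alphaLift (-α) σ B))
    convex_posDef.isPreconnected (hsmooth.differentiableOn (by simp)) (fun ρ hρ => ?_) hσ hτ
  ext V
  -- Constant fields reach every direction at `ρ`; both covariant derivatives then vanish.
  have := hdual (fun _ => V) _ _ contDiffOn_const hA hB ρ hρ
  rw [alphaConnection_eq_zero_of_eqOn_alphaLift hα.2 (Set.eqOn_refl _ _) hρ,
    alphaConnection_eq_zero_of_eqOn_alphaLift hα' (Set.eqOn_refl _ _) hρ] at this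
  simpa using this

/-! ### Dimension count and the affine chart. -/

/-- A complex matrix is the same as a pair of Hermitian matrices: its real and imaginary parts. -/
def matrixEquivHermProd (N : ℕ) : Matrix (Fin N) (Fin N) ℂ ≃ₗ[ℝ] Herm N × Herm N :=
  LinearEquiv.ofBijective
    (LinearMap.prod (realPart : _ →ₗ[ℝ] selfAdjoint (Matrix (Fin N) (Fin N) ℂ))
      (imaginaryPart : _ →ₗ[ℝ] selfAdjoint (Matrix (Fin N) (Fin N) ℂ)))
    ⟨fun a b h => by
      have h1 : realPart a = realPart b := congrArg Prod.fst h
      have h2 : imaginaryPart a = imaginaryPart b := congrArg Prod.snd h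
      rw [← realPart_add_I_smul_imaginaryPart a, h1, h2, realPart_add_I_smul_imaginaryPart b],
    fun x => ⟨x.1.1 + Complex.I • x.2.1, by
      refine Prod.ext ?_ ?_
      · change realPart (x.1.1 + Complex.I • x.2.1) = x.1
        rw [map_add, realPart_I_smul, selfAdjoint.realPart_coe, selfAdjoint.imaginaryPart_coe,
          neg_zero, add_zero]
      · change imaginaryPart (x.1.1 + Complex.I • x.2.1) = x.2
        rw [map_add, imaginaryPart_I_smul, selfAdjoint.realPart_coe,
          selfAdjoint.imaginaryPart_coe, zero_add]⟩⟩

instance : FiniteDimensional ℝ (Herm N) :=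
  Module.Finite.of_surjective ((LinearMap.fst ℝ (Herm N) (Herm N)) ∘ₗ
    (matrixEquivHermProd N).toLinearMap)
    (Prod.fst_surjective.comp (matrixEquivHermProd N).surjective)

theorem finrank_herm (N : ℕ) : Module.finrank ℝ (Herm N) = N ^ 2 := by
  have h := (matrixEquivHermProd N).finrank_eq
  rw [Module.finrank_prod, Module.finrank_matrix, Complex.finrank_real_complex] at h
  simp at h
  nlinarith

/-- Linear coordinates on the space of Hermitian matrices. -/
def hermCoord (N : ℕ) : Herm N ≃L[ℝ] (Fin (N ^ 2) → ℝ) :=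
  ContinuousLinearEquiv.ofFinrankEq (by rw [finrank_herm, Module.finrank_fin_fun])

theorem sum_hermCoord_smul (A : Herm N) :
    ∑ k, hermCoord N A k • (hermCoord N).symm (Pi.single k 1) = A := by
  refine (hermCoord N).injective ?_
  rw [map_sum]
  conv_rhs => rw [pi_eq_sum_univ' (hermCoord N A)]
  refine Finset.sum_congr rfl fun k _ => ?_
  rw [map_smul, ContinuousLinearEquiv.apply_symm_apply]

/-- The global coordinates given by the `α`-embedding. -/
def alphaCoord (N : ℕ) (hα : α < 1) : CoordinateSystem N where
  chart :=
    { toFun := fun σ => hermCoord N (embed α σ)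
      invFun := fun x => unembed α ((hermCoord N).symm x)
      source := posDef N
      target := (hermCoord N).symm ⁻¹' posDef N
      map_source' := fun σ hσ => by simpa using embed_mem_posDef hα hσ
      map_target' := fun x hx => unembed_mem_posDef hα hx
      left_inv' := fun σ hσ => by simpa using unembed_embed hα hσ
      right_inv' := fun x hx => by rw [embed_unembed hα hx]; simp
      open_source := isOpen_posDef
      open_target := isOpen_posDef.preimage (hermCoord N).symm.continuous
      continuousOn_toFun :=
        (hermCoord N).continuous.comp_continuousOn (contDiffOn_embed α).continuousOn
      continuousOn_invFun := (contDiffOn_unembed hα).continuousOn.comp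
        (hermCoord N).symm.continuous.continuousOn fun _ hx => hx }
  source_eq := rfl
  smooth := (hermCoord N).contDiff.comp_contDiffOn (contDiffOn_embed α)
  smooth_symm := (contDiffOn_unembed hα).comp (hermCoord N).symm.contDiff.contDiffOn
    fun _ hx => hx

theorem partialField_alphaCoord (hα : α < 1) (i : Fin (N ^ 2)) {σ : Herm N}
    (hσ : σ ∈ posDef N) :
    (alphaCoord N hα).partialField i σ =
      alphaLift α σ ((hermCoord N).symm (Pi.single i 1)) := by
  change fderiv ℝ (unembed α ∘ (hermCoord N).symm) (hermCoord N (embed α σ)) _ = _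
  have hd : DifferentiableAt ℝ (unembed α)
      ((hermCoord N).symm (hermCoord N (embed α σ))) := by
    rw [ContinuousLinearEquiv.symm_apply_apply]
    exact differentiableAt_unembed hα (embed_mem_posDef hα hσ)
  rw [fderiv_comp _ hd (hermCoord N).symm.differentiableAt, ContinuousLinearEquiv.fderiv,
    ContinuousLinearEquiv.symm_apply_apply]
  rfl

theorem isAffine_alphaCoord (hα : α < 1) :
    (alphaCoord N hα).IsAffine (alphaConnection α) := fun _ _ _ hσ =>
  alphaConnection_eq_zero_of_eqOn_alphaLift hα
    (fun _ hτ => partialField_alphaCoord hα _ hτ) hσ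

/-! ### Nondegeneracy of the trace form and comparison of the metrics. -/

/-- The trace form on Hermitian matrices. -/
def traceForm (N : ℕ) : Herm N →ₗ[ℝ] Herm N →ₗ[ℝ] ℝ :=
  LinearMap.mk₂ ℝ (fun A B => (Matrix.trace (A.mat * B.mat)).re)
    (fun A A' B => by
      change (Matrix.trace ((A.mat + A'.mat) * B.mat)).re = _
      simp [add_mul])
    (fun c A B => by
      change (Matrix.trace ((c • A.mat) * B.mat)).re = _
      simp)
    (fun A B B' => by
      change (Matrix.trace (A.mat * (B.mat + B'.mat))).re = _
      simp [mul_add])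
    (fun c A B => by
      change (Matrix.trace (A.mat * (c • B.mat))).re = _
      simp)

theorem traceForm_apply (A B : Herm N) :
    traceForm N A B = (Matrix.trace (A.mat * B.mat)).re := rfl

theorem traceForm_injective : Function.Injective (traceForm N) := by
  refine (injective_iff_map_eq_zero _).2 fun A hA => Herm.mat_injective ?_
  have h := DFunLike.congr_fun hA A
  rw [traceForm_apply] at h
  have hh : A.mat.conjTranspose = A.mat := A.isSelfAdjoint
  change A.mat = 0
  rw [← Matrix.trace_conjTranspose_mul_self_eq_zero_iff, hh]
  -- The form sees only the real part; the trace of `A²` is real because it equals its conjugate.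
  refine Complex.ext h ?_
  have : star (Matrix.trace (A.mat * A.mat)) = Matrix.trace (A.mat * A.mat) := by
    rw [← Matrix.trace_conjTranspose, Matrix.conjTranspose_mul, hh]
  exact Complex.conj_eq_iff_im.1 this

theorem exists_traceForm_eq (f : Herm N →ₗ[ℝ] ℝ) : ∃ A, traceForm N A = f :=
  (LinearMap.injective_iff_surjective_of_finrank_eq_finrank
    Subspace.dual_finrank_eq.symm).1 traceForm_injective f

/-- A metric making the `α`-connection and the `-α`-connection dual is the trace
form in the `α`- and `-α`-representations, up to a change of the first argument which does not
depend on the base point. -/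
theorem exists_form_alphaLift_eq_traceForm (hα : α ∈ Set.Ioo (-1 : ℝ) 1) (g : RiemannianMetric N)
    (hdual : AreDual g (alphaConnection α) (alphaConnection (-α))) (A : Herm N) :
    ∃ A' : Herm N, ∀ σ ∈ posDef N, ∀ B : Herm N,
      g.form σ (alphaLift α σ A) B = traceForm N A' (alphaRep (-α) σ B) := by
  -- A reference point `ρ` is needed, at which `A'` represents the functional; constancy carries it
  -- to every `σ`.
  rcases (posDef N).eq_empty_or_nonempty with h | ⟨ρ, hρ⟩
  · exact ⟨0, fun σ hσ => by simp [h] at hσ⟩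
  obtain ⟨A', hA'⟩ := exists_traceForm_eq
    ((g.form ρ (alphaLift α ρ A) ∘L alphaLift (-α) ρ : Herm N →L[ℝ] ℝ) : Herm N →ₗ[ℝ] ℝ)
  refine ⟨A', fun σ hσ B => ?_⟩
  have hα' : -α < 1 := by linarith [hα.1]
  rw [hA']
  refine Eq.trans ?_ (form_alphaLift_const hα g hdual A (alphaRep (-α) σ B) hσ hρ)
  rw [alphaLift_alphaRep hα' hσ]

theorem exists_affine_coordinateSystem_form_eq_sum_wyd
    (hα : α ∈ Set.Ioo (-1 : ℝ) 1) (g : RiemannianMetric N)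
    (hdual : AreDual g
      (alphaConnection α) (alphaConnection (-α))) :
    ∃ θ : CoordinateSystem N,
      θ.IsAffine (alphaConnection α) ∧
      ∃ M : Matrix (Fin (N ^ 2)) (Fin (N ^ 2)) ℝ,
        ∀ σ ∈ posDef N, ∀ i j : Fin (N ^ 2),
          g.form σ (θ.partialField i σ) (θ.partialField j σ) =
            ∑ k : Fin (N ^ 2),
              M i k * wyd α σ (θ.partialField k σ) (θ.partialField j σ) := by
  choose T hT using fun A => exists_form_alphaLift_eq_traceForm hα g hdual A
  refine ⟨alphaCoord N hα.2, isAffine_alphaCoord hα.2,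
    -- Row `i` of `M` holds the coordinates of `T` at the `i`-th basis vector. Linearity of `T` is
    -- never needed.
    fun i => hermCoord N (T ((hermCoord N).symm (Pi.single i 1))), fun σ hσ i j => ?_⟩
  rw [partialField_alphaCoord hα.2 i hσ, hT _ σ hσ]
  conv_lhs => rw [← sum_hermCoord_smul (T ((hermCoord N).symm (Pi.single i 1)))]
  rw [map_sum, LinearMap.sum_apply]
  refine Finset.sum_congr rfl fun k _ => ?_
  rw [map_smul, LinearMap.smul_apply, smul_eq_mul, partialField_alphaCoord hα.2 k hσ, wyd,
    alphaRep_alphaLift hα.2 hσ, traceForm_apply]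

end

end AlphaGeometry

theorem theorem3 (N : ℕ) (α : ℝ) (hα : α ∈ Set.Ioo (-1 : ℝ) 1)
    (g : AlphaGeometry.RiemannianMetric N)
    (hdual : AlphaGeometry.AreDual g
      (AlphaGeometry.alphaConnection α) (AlphaGeometry.alphaConnection (-α))) :
    ∃ θ : AlphaGeometry.CoordinateSystem N,
      θ.IsAffine (AlphaGeometry.alphaConnection α) ∧
      ∃ M : Matrix (Fin (N ^ 2)) (Fin (N ^ 2)) ℝ,
        ∀ σ ∈ AlphaGeometry.posDef N, ∀ i j : Fin (N ^ 2),
          g.form σ (θ.partialField i σ) (θ.partialField j σ) =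
            ∑ k : Fin (N ^ 2),
              M i k * AlphaGeometry.wyd α σ (θ.partialField k σ) (θ.partialField j σ) :=
  AlphaGeometry.exists_affine_coordinateSystem_form_eq_sum_wyd hα g hdual
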